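/- Let $\Bbbk$ be an algebraically closed field of characteristic zero, let $G$ be a finite group, and let $H$ be either the group algebra $\Bbbk G$ or its dual Hopf algebra $(\Bbbk G)^*$. Let $R$ be a (not necessarily commutative) $\Bbbk$-algebra which is a domain and is left and right noetherian, and suppose that $R$ is a left $H$-module algebra, with action written $h \rhd r$. Suppose that the action is inner faithful, that is, $I \rhd R \neq 0$ for every nonzero Hopf ideal $I$ of $H$. Let $R^H = \{ r \in R \mid h \rhd r = \varepsilon(h) r \text{ for all } h \in H \}$ be the invariant subring, where $\varepsilon$ is the counit of $H$. Let $R \# H$ be the smash product, that is, the vector space $R \otimes_{\Bbbk} H$ with multiplication $(r \# h)(s \# g) = \sum r (h_1 \rhd s) \# h_2 g$, where $\Delta(h) = \sum h_1 \otimes h_2$. Then the Auslander map $$\varphi : R \# H \longrightarrow \operatorname{End}_{R^H}(R), \qquad r \# h \longmapsto \big( x \mapsto r (h \rhd x) \big),$$ where $R$ is regarded as a right $R^H$-module, is injective, and the ring $R \# H$ is prime. (In particular the two properties, injectivity of $\varphi$ and primeness of $R \# H$, are equivalent here.) -/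

import Mathlib

open scoped TensorProduct

/-! ### The dual of a finite-dimensional Hopf algebra -/

/-- The dual `H^*` of a Hopf algebra `H` over `k`: all linear functionals on `H`, with the
convolution product `(f * g) h = ∑ f h₁ * g h₂` and with unit the counit of `H` (this is the
algebra structure that `WithConv` carries). -/
def HopfDual (k H : Type*) [Field k] [Ring H] [HopfAlgebra k H] : Type _ :=
  WithConv (H →ₗ[k] k)

namespace HopfDual

open Coalgebra

section Algebra

variable {k H : Type*} [Field k] [Ring H] [HopfAlgebra k H]

noncomputable instance : Ring (HopfDual k H) := inferInstanceAs (Ring (WithConv (H →ₗ[k] k)))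

noncomputable instance : Algebra k (HopfDual k H) :=
  inferInstanceAs (Algebra k (WithConv (H →ₗ[k] k)))

instance : FunLike (HopfDual k H) H k where
  coe f := f.ofConv
  coe_injective _ _ h := WithConv.ofConv_injective (DFunLike.coe_injective h)

variable (k H) in
/-- The elements of `H^*` are the linear functionals on `H`. -/
noncomputable def equivDual : HopfDual k H ≃ₗ[k] Module.Dual k H where
  toFun f := f.ofConv
  invFun f := WithConv.toConv f
  map_add' _ _ := rfl
  map_smul' _ _ := rfl

@[simp]
theorem equivDual_apply (f : HopfDual k H) (a : H) : equivDual k H f a = f a := rfl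

@[simp]
theorem equivDual_symm_apply (f : Module.Dual k H) (a : H) : (equivDual k H).symm f a = f a := rfl

@[ext]
theorem ext {f g : HopfDual k H} (h : ∀ a, f a = g a) : f = g := DFunLike.ext _ _ h

@[simp] theorem zero_apply (a : H) : (0 : HopfDual k H) a = 0 := rfl

@[simp] theorem add_apply (f g : HopfDual k H) (a : H) : (f + g) a = f a + g a := rfl

@[simp] theorem smul_apply (c : k) (f : HopfDual k H) (a : H) : (c • f) a = c * f a := rfl

theorem map_sum_apply (f : HopfDual k H) {ι : Type*} (s : Finset ι) (a : ι → H) :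
    f (∑ i ∈ s, a i) = ∑ i ∈ s, f (a i) := map_sum (equivDual k H f) a s

theorem map_smul_apply (f : HopfDual k H) (c : k) (a : H) : f (c • a) = c * f a :=
  map_smul (equivDual k H f) c a

@[simp] theorem one_apply (a : H) : (1 : HopfDual k H) a = counit a := rfl

theorem mul_apply (f g : HopfDual k H) {a : H} {ι : Type*} (A : Coalgebra.Repr k a ι) :
    (f * g) a = ∑ i ∈ A.index, f (A.left i) * g (A.right i) :=
  A.convMul_apply (f : WithConv (H →ₗ[k] k)) g

theorem mul_apply_mul {a b : H} {ι κ : Type*} (A : Coalgebra.Repr k a ι)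
    (B : Coalgebra.Repr k b κ) (f g : HopfDual k H) :
    (f * g) (a * b) = ∑ i ∈ A.index, ∑ j ∈ B.index,
      f (A.left i * B.left j) * g (A.right i * B.right j) := by
  change LinearMap.mul' k k (TensorProduct.map (equivDual k H f) (equivDual k H g)
    (comul (a * b))) = _
  simp [Bialgebra.comul_mul, ← A.eq, ← B.eq, Finset.sum_mul_sum]

theorem mul_apply_one (f g : HopfDual k H) : (f * g) 1 = f 1 * g 1 := by
  change LinearMap.mul' k k (TensorProduct.map (equivDual k H f) (equivDual k H g)
    (comul 1)) = _
  simp [Algebra.TensorProduct.one_def]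

end Algebra

variable {k H : Type*} [Field k] [Ring H] [HopfAlgebra k H] [Module.Finite k H]

variable (k H) in
/-- For `H` finite-dimensional, the canonical isomorphism `H^* ⊗ H^* ≃ (H ⊗ H)^*`, which sends
`f ⊗ g` to `a ⊗ b ↦ f a * g b`. -/
noncomputable def pairing : HopfDual k H ⊗[k] HopfDual k H ≃ₗ[k] Module.Dual k (H ⊗[k] H) :=
  (TensorProduct.congr (equivDual k H) (equivDual k H)).trans
    (TensorProduct.dualDistribEquiv k H H)

@[simp]
theorem pairing_tmul (f g : HopfDual k H) (a b : H) :
    pairing k H (f ⊗ₜ g) (a ⊗ₜ b) = f a * g b := rfl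

/-- The comultiplication of `H^*` is the transpose `H^* → (H ⊗ H)^* ≃ H^* ⊗ H^*` of the
multiplication of `H`, its counit is evaluation at `1`. -/
noncomputable instance : CoalgebraStruct k (HopfDual k H) where
  comul := (pairing k H).symm.toLinearMap ∘ₗ (LinearMap.mul' k H).dualMap ∘ₗ
    (equivDual k H).toLinearMap
  counit := LinearMap.applyₗ (1 : H) ∘ₗ (equivDual k H).toLinearMap

@[simp]
theorem pairing_comul (f : HopfDual k H) (a b : H) :
    pairing k H (comul f) (a ⊗ₜ b) = f (a * b) := by
  simp [comul]

@[simp]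
theorem counit_apply (f : HopfDual k H) : counit (R := k) f = f 1 := rfl

theorem pairing_ext {s t : HopfDual k H ⊗[k] HopfDual k H}
    (h : ∀ a b : H, pairing k H s (a ⊗ₜ b) = pairing k H t (a ⊗ₜ b)) : s = t := by
  apply (pairing k H).injective
  exact TensorProduct.ext' h

variable (k H) in
/-- The canonical map `H^* ⊗ (H^* ⊗ H^*) → (H ⊗ (H ⊗ H))^*`. -/
noncomputable def pairing₃ : HopfDual k H ⊗[k] (HopfDual k H ⊗[k] HopfDual k H) ≃ₗ[k]
    Module.Dual k (H ⊗[k] (H ⊗[k] H)) :=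
  (TensorProduct.congr (equivDual k H) (pairing k H)).trans
    (TensorProduct.dualDistribEquiv k H (H ⊗[k] H))

@[simp]
theorem pairing₃_tmul (f : HopfDual k H) (t : HopfDual k H ⊗[k] HopfDual k H) (a : H)
    (u : H ⊗[k] H) : pairing₃ k H (f ⊗ₜ t) (a ⊗ₜ u) = f a * pairing k H t u := rfl

theorem pairing₃_assoc_tmul (s : HopfDual k H ⊗[k] HopfDual k H) (g : HopfDual k H) (a b c : H) :
    pairing₃ k H (TensorProduct.assoc k _ _ _ (s ⊗ₜ g)) (a ⊗ₜ (b ⊗ₜ c)) =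
      pairing k H s (a ⊗ₜ b) * g c := by
  induction s with
  | zero => simp
  | tmul x y => simp [mul_assoc]
  | add x y hx hy => simp [TensorProduct.add_tmul, hx, hy, add_mul]

theorem pairing₃_assoc_rTensor_comul (t : HopfDual k H ⊗[k] HopfDual k H) (a b c : H) :
    pairing₃ k H (TensorProduct.assoc k _ _ _ (comul.rTensor _ t)) (a ⊗ₜ (b ⊗ₜ c)) =
      pairing k H t ((a * b) ⊗ₜ c) := by
  induction t with
  | zero => simp
  | tmul x y => simp [pairing₃_assoc_tmul]
  | add x y hx hy => simp [hx, hy]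

theorem pairing₃_lTensor_comul (t : HopfDual k H ⊗[k] HopfDual k H) (a b c : H) :
    pairing₃ k H (comul.lTensor _ t) (a ⊗ₜ (b ⊗ₜ c)) = pairing k H t (a ⊗ₜ (b * c)) := by
  induction t with
  | zero => simp
  | tmul x y => simp
  | add x y hx hy => simp [hx, hy]

theorem lid_rTensor_counit (t : HopfDual k H ⊗[k] HopfDual k H) (a : H) :
    (TensorProduct.lid k _ (counit.rTensor _ t)) a = pairing k H t (1 ⊗ₜ a) := by
  induction t with
  | zero => simp
  | tmul x y => simp
  | add x y hx hy => simp [hx, hy]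

theorem rid_lTensor_counit (t : HopfDual k H ⊗[k] HopfDual k H) (a : H) :
    (TensorProduct.rid k _ (counit.lTensor _ t)) a = pairing k H t (a ⊗ₜ 1) := by
  induction t with
  | zero => simp
  | tmul x y => simp [mul_comm]
  | add x y hx hy => simp [hx, hy]

noncomputable instance : Coalgebra k (HopfDual k H) where
  coassoc := by
    ext f : 1
    apply (pairing₃ k H).injective
    refine TensorProduct.ext' fun a u => ?_
    induction u with
    | zero => simp
    | tmul b c =>
      simp [pairing₃_assoc_rTensor_comul, pairing₃_lTensor_comul, mul_assoc]
    | add x y hx hy => simp only [TensorProduct.tmul_add, map_add, hx, hy]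
  rTensor_counit_comp_comul := by
    ext f : 1
    apply (TensorProduct.lid k _).injective
    apply HopfDual.ext
    intro a
    simpa using lid_rTensor_counit (comul f) a
  lTensor_counit_comp_comul := by
    ext f : 1
    apply (TensorProduct.rid k _).injective
    apply HopfDual.ext
    intro a
    simpa using rid_lTensor_counit (comul f) a

theorem pairing_mul {a b : H} {ι κ : Type*} (A : Coalgebra.Repr k a ι) (B : Coalgebra.Repr k b κ)
    (s t : HopfDual k H ⊗[k] HopfDual k H) :
    pairing k H (s * t) (a ⊗ₜ b) = ∑ i ∈ A.index, ∑ j ∈ B.index,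
      pairing k H s (A.left i ⊗ₜ B.left j) * pairing k H t (A.right i ⊗ₜ B.right j) := by
  induction s with
  | zero => simp
  | add x y hx hy => simp [add_mul, hx, hy, Finset.sum_add_distrib]
  | tmul f g =>
    induction t with
    | zero => simp
    | add x y hx hy => simp [mul_add, hx, hy, Finset.sum_add_distrib]
    | tmul f' g' =>
      simp only [Algebra.TensorProduct.tmul_mul_tmul, pairing_tmul, mul_apply _ _ A,
        mul_apply _ _ B, Finset.sum_mul_sum]
      exact Finset.sum_congr rfl fun i _ => Finset.sum_congr rfl fun j _ => by ring

noncomputable instance : Bialgebra k (HopfDual k H) :=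
  Bialgebra.mk' k (HopfDual k H)
    (by simp)
    (by
      intro f g
      exact mul_apply_one f g)
    (by
      refine pairing_ext fun a b => ?_
      simp [Algebra.TensorProduct.one_def])
    (by
      intro f g
      refine pairing_ext fun a b => ?_
      simp [pairing_mul (ℛ k a) (ℛ k b), mul_apply_mul (ℛ k a) (ℛ k b)])

/-- The antipode of `H^*` is the transpose of the antipode of `H`. -/
noncomputable instance : HopfAlgebraStruct k (HopfDual k H) where
  antipode := (equivDual k H).symm.toLinearMap ∘ₗ
    (HopfAlgebra.antipode k (A := H)).dualMap ∘ₗ (equivDual k H).toLinearMap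

@[simp]
theorem antipode_apply (f : HopfDual k H) (a : H) :
    (HopfAlgebra.antipode k f) a = f (HopfAlgebra.antipode k a) := rfl

theorem mul'_rTensor_antipode {a : H} {ι : Type*} (A : Coalgebra.Repr k a ι)
    (t : HopfDual k H ⊗[k] HopfDual k H) :
    (LinearMap.mul' k _ ((HopfAlgebra.antipode k).rTensor _ t)) a =
      ∑ i ∈ A.index, pairing k H t (HopfAlgebra.antipode k (A.left i) ⊗ₜ A.right i) := by
  induction t with
  | zero => simp
  | tmul x y => simp [mul_apply _ _ A]
  | add x y hx hy => simp [hx, hy, Finset.sum_add_distrib]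

theorem mul'_lTensor_antipode {a : H} {ι : Type*} (A : Coalgebra.Repr k a ι)
    (t : HopfDual k H ⊗[k] HopfDual k H) :
    (LinearMap.mul' k _ ((HopfAlgebra.antipode k).lTensor _ t)) a =
      ∑ i ∈ A.index, pairing k H t (A.left i ⊗ₜ HopfAlgebra.antipode k (A.right i)) := by
  induction t with
  | zero => simp
  | tmul x y => simp [mul_apply _ _ A]
  | add x y hx hy => simp [hx, hy, Finset.sum_add_distrib]

/-- The dual Hopf algebra `H^*` of a finite-dimensional Hopf algebra `H`. -/
noncomputable instance : HopfAlgebra k (HopfDual k H) where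
  mul_antipode_rTensor_comul := by
    ext f : 1
    apply HopfDual.ext
    intro a
    simp only [LinearMap.comp_apply, mul'_rTensor_antipode (ℛ k a), pairing_comul]
    rw [← map_sum_apply, HopfAlgebra.sum_antipode_mul_eq_algebraMap_counit]
    simp [Algebra.algebraMap_eq_smul_one, map_smul_apply, mul_comm]
  mul_antipode_lTensor_comul := by
    ext f : 1
    apply HopfDual.ext
    intro a
    simp only [LinearMap.comp_apply, mul'_lTensor_antipode (ℛ k a), pairing_comul]
    rw [← map_sum_apply, HopfAlgebra.sum_mul_antipode_eq_algebraMap_counit]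
    simp [Algebra.algebraMap_eq_smul_one, map_smul_apply, mul_comm]

end HopfDual

/-! ### Hopf algebra actions, invariants and inner faithfulness -/

/-- An action of a Hopf algebra `H` on an algebra `R`, that is, the structure of a left `H`-module
algebra on `R`: an `H`-module structure `h ▷ r = act h r` on the vector space `R` such that
`h ▷ 1 = ε(h) 1` and `h ▷ (a b) = ∑ (h₁ ▷ a) (h₂ ▷ b)`. -/
structure HopfAction (k H R : Type*) [Field k] [Ring H] [HopfAlgebra k H] [Ring R]
    [Algebra k R] where
  act : H →ₐ[k] Module.End k R
  act_one : ∀ h : H, act h 1 = algebraMap k R (Coalgebra.counit h)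
  act_mul : ∀ (h : H) (a b : R), act h (a * b) = LinearMap.mul' k R
    (TensorProduct.map (act.toLinearMap.flip a) (act.toLinearMap.flip b) (Coalgebra.comul h))

namespace HopfAction

open Coalgebra

variable {k H R : Type*} [Field k] [Ring H] [HopfAlgebra k H] [Ring R] [Algebra k R]

theorem act_mul_repr (ρ : HopfAction k H R) {h : H} {ι : Type*} (A : Coalgebra.Repr k h ι)
    (a b : R) : ρ.act h (a * b) = ∑ i ∈ A.index, ρ.act (A.left i) a * ρ.act (A.right i) b := by
  simp [ρ.act_mul, ← A.eq]

/-- The action is inner faithful if no nonzero Hopf ideal of `H` annihilates `R`. -/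
def InnerFaithful (ρ : HopfAction k H R) : Prop :=
  ∀ I : Ideal H, I.IsTwoSided → I.IsHopfIdeal k → I ≠ ⊥ → ∃ h ∈ I, ∃ r : R, ρ.act h r ≠ 0

/-- The invariant subring `R^H`. -/
def invariants (ρ : HopfAction k H R) : Subalgebra k R where
  carrier := {r | ∀ h : H, ρ.act h r = (counit h : k) • r}
  mul_mem' := by
    intro a b ha hb h
    simp only [Set.mem_ofPred_eq] at ha hb
    rw [ρ.act_mul_repr (ℛ k h)]
    simp only [ha, hb, smul_mul_smul_comm, ← Finset.sum_smul]
    congr 1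
    have := congr(counit (R := k) $(Coalgebra.sum_counit_smul (ℛ k h)))
    simpa using this
  add_mem' := by
    intro a b ha hb h
    simp only [Set.mem_ofPred_eq] at ha hb
    simp [ha, hb]
  algebraMap_mem' := by
    intro c h
    simp [Algebra.algebraMap_eq_smul_one, ρ.act_one, smul_comm c]

theorem mem_invariants (ρ : HopfAction k H R) {r : R} :
    r ∈ ρ.invariants ↔ ∀ h : H, ρ.act h r = (counit h : k) • r := Iff.rfl

theorem act_mul_invariant (ρ : HopfAction k H R) (h : H) (x : R) {c : R}
    (hc : c ∈ ρ.invariants) : ρ.act h (x * c) = ρ.act h x * c := by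
  rw [ρ.act_mul_repr (ℛ k h)]
  have key : ∑ i ∈ (ℛ k h).index, (counit (R := k) ((ℛ k h).right i)) • (ℛ k h).left i = h := by
    simpa only [map_sum, TensorProduct.rid_tmul, one_smul] using
      congr(TensorProduct.rid k H $(Coalgebra.sum_tmul_counit_eq (ℛ k h)))
  conv_rhs => rw [← key]
  simp [ρ.mem_invariants.1 hc, Finset.sum_mul]

end HopfAction

/-! ### The smash product -/

/-- The smash product `R # H`, with underlying vector space `R ⊗ H`; the element `r # h` is
`SmashProduct.mk ρ r h`. -/
def SmashProduct {k H R : Type*} [Field k] [Ring H] [HopfAlgebra k H] [Ring R] [Algebra k R]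
    (_ρ : HopfAction k H R) : Type _ := R ⊗[k] H

namespace SmashProduct

open Coalgebra

variable {k H R : Type*} [Field k] [Ring H] [HopfAlgebra k H] [Ring R] [Algebra k R]
variable (ρ : HopfAction k H R)

noncomputable instance : AddCommGroup (SmashProduct ρ) :=
  inferInstanceAs (AddCommGroup (R ⊗[k] H))

noncomputable instance : Module k (SmashProduct ρ) :=
  inferInstanceAs (Module k (R ⊗[k] H))

/-- The element `r # h`. -/
noncomputable def mk (r : R) (h : H) : SmashProduct ρ := (r ⊗ₜ[k] h : R ⊗[k] H)

/-- Left multiplication by `r # 1`, that is, `s # g ↦ r s # g`. -/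
noncomputable def leftR : R →ₐ[k] Module.End k (R ⊗[k] H) :=
  Module.endTensorEndAlgHom.comp
    (Algebra.TensorProduct.includeLeft.comp (Algebra.lmul k R))

/-- Left multiplication by `1 # h`, that is, `s # g ↦ ∑ (h₁ ▷ s) # h₂ g`. -/
noncomputable def leftH : H →ₐ[k] Module.End k (R ⊗[k] H) :=
  Module.endTensorEndAlgHom.comp
    ((Algebra.TensorProduct.map ρ.act (Algebra.lmul k H)).comp (Bialgebra.comulAlgHom k H))

/-- Left multiplication: `r # h` acts as left multiplication by `1 # h` followed by left
multiplication by `r # 1`. -/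
noncomputable def leftMul : R ⊗[k] H →ₗ[k] Module.End k (R ⊗[k] H) :=
  TensorProduct.lift ((LinearMap.mul k (Module.End k (R ⊗[k] H))).compl₁₂
    (leftR (k := k) (H := H) (R := R)).toLinearMap (leftH ρ).toLinearMap)

theorem leftR_tmul (r s : R) (g : H) :
    leftR (k := k) r (s ⊗ₜ[k] g) = (r * s) ⊗ₜ[k] g := by
  simp [leftR, Module.endTensorEndAlgHom_apply]

theorem leftH_tmul {h : H} {ι : Type*} (A : Coalgebra.Repr k h ι) (s : R) (g : H) :
    leftH ρ h (s ⊗ₜ[k] g) = ∑ i ∈ A.index, ρ.act (A.left i) s ⊗ₜ[k] (A.right i * g) := by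
  simp [leftH, ← A.eq, Module.endTensorEndAlgHom_apply]

theorem leftMul_tmul (r : R) (h : H) : leftMul ρ (r ⊗ₜ[k] h) = leftR r * leftH ρ h := rfl

theorem leftH_mul_leftR {h : H} {ι : Type*} (A : Coalgebra.Repr k h ι) (s : R) :
    leftH ρ h * leftR s = ∑ i ∈ A.index, leftR (ρ.act (A.left i) s) * leftH ρ (A.right i) := by
  refine TensorProduct.ext' fun t g => ?_
  have key := Coalgebra.sum_tmul_tmul_eq A (fun i => ℛ k (A.left i)) (fun i => ℛ k (A.right i))
  have key' := congr((TensorProduct.map (LinearMap.mul' k R) (LinearMap.id (M := H)))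
    ((TensorProduct.assoc k R R H).symm
      (TensorProduct.map (ρ.act.toLinearMap.flip s) (TensorProduct.map (ρ.act.toLinearMap.flip t)
        (LinearMap.mulRight k g)) $key)))
  simp only [map_sum, TensorProduct.map_tmul, TensorProduct.assoc_symm_tmul,
    LinearMap.mul'_apply, LinearMap.flip_apply, AlgHom.toLinearMap_apply,
    LinearMap.mulRight_apply, LinearMap.id_apply] at key'
  simp only [Module.End.mul_apply, leftR_tmul, leftH_tmul ρ A, LinearMap.sum_apply, map_sum,
    leftH_tmul ρ (ℛ k (A.right _)), ρ.act_mul_repr (ℛ k (A.left _)), TensorProduct.sum_tmul]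
  exact key'

theorem leftMul_leftMul (x y : R ⊗[k] H) :
    leftMul ρ (leftMul ρ x y) = leftMul ρ x * leftMul ρ y := by
  induction x with
  | zero => simp
  | add a b ha hb => simp [add_mul, ha, hb]
  | tmul r h =>
    induction y with
    | zero => simp
    | add a b ha hb => simp [mul_add, ha, hb]
    | tmul s g =>
      rw [leftMul_tmul, leftMul_tmul, mul_assoc, ← mul_assoc (leftH ρ h),
        leftH_mul_leftR ρ (ℛ k h)]
      simp [leftH_tmul ρ (ℛ k h), leftR_tmul, leftMul_tmul, Finset.sum_mul, Finset.mul_sum,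
        mul_assoc]

theorem leftMul_one (x : R ⊗[k] H) : leftMul ρ x (1 ⊗ₜ[k] 1) = x := by
  induction x with
  | zero => simp
  | add a b ha hb => simp [ha, hb]
  | tmul r h =>
    rw [leftMul_tmul, Module.End.mul_apply, leftH_tmul ρ (ℛ k h)]
    simp only [ρ.act_one, mul_one, Algebra.algebraMap_eq_smul_one, TensorProduct.smul_tmul,
      ← TensorProduct.tmul_sum, Coalgebra.sum_counit_smul, leftR_tmul]

theorem one_leftMul : leftMul ρ (1 ⊗ₜ[k] 1) = 1 := by
  rw [leftMul_tmul, map_one, map_one, one_mul]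

/-- The multiplication of `R # H` is `(r # h) (s # g) = ∑ r (h₁ ▷ s) # h₂ g`, see `mk_mul_mk`. -/
noncomputable instance : Mul (SmashProduct ρ) := ⟨fun x y => leftMul ρ x y⟩

noncomputable instance : One (SmashProduct ρ) := ⟨mk ρ 1 1⟩

theorem one_def : (1 : SmashProduct ρ) = mk ρ 1 1 := rfl

theorem mk_mul_mk (r s : R) (h g : H) {ι : Type*} (A : Coalgebra.Repr k h ι) :
    mk ρ r h * mk ρ s g = ∑ i ∈ A.index, mk ρ (r * ρ.act (A.left i) s) (A.right i * g) := by
  change leftMul ρ (r ⊗ₜ[k] h) (s ⊗ₜ[k] g) = _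
  rw [leftMul_tmul, Module.End.mul_apply, leftH_tmul ρ A, map_sum]
  simp only [leftR_tmul]
  rfl

noncomputable instance : Ring (SmashProduct ρ) where
  __ := (inferInstance : AddCommGroup (SmashProduct ρ))
  left_distrib x y z := map_add (leftMul ρ x) y z
  right_distrib x y z := congr($(map_add (leftMul ρ) x y) z)
  zero_mul x := congr($(map_zero (leftMul ρ)) x)
  mul_zero x := map_zero (leftMul ρ x)
  mul_assoc x y z := congr($(leftMul_leftMul ρ x y) z)
  one_mul x := congr($(one_leftMul ρ) x)
  mul_one x := leftMul_one ρ x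

noncomputable instance : Algebra k (SmashProduct ρ) :=
  Algebra.ofModule (fun c x y => congr($(map_smul (leftMul ρ) c x) y))
    (fun c x y => map_smul (leftMul ρ x) c y)

/-- The map `R ⊗ H → End_k(R)`, `r # h ↦ (x ↦ r (h ▷ x))`. -/
noncomputable def toEnd : R ⊗[k] H →ₗ[k] Module.End k R :=
  TensorProduct.lift ((LinearMap.mul k (Module.End k R)).compl₁₂
    (Algebra.lmul k R).toLinearMap ρ.act.toLinearMap)

theorem toEnd_tmul (r : R) (h : H) (x : R) : toEnd ρ (r ⊗ₜ[k] h) x = r * ρ.act h x := rfl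

theorem toEnd_mul_invariant (u : R ⊗[k] H) (x : R) {c : R} (hc : c ∈ ρ.invariants) :
    toEnd ρ u (x * c) = toEnd ρ u x * c := by
  induction u with
  | zero => simp
  | add a b ha hb => simp [ha, hb, add_mul]
  | tmul r h => simp [toEnd_tmul, ρ.act_mul_invariant h x hc, mul_assoc]

theorem toEnd_leftMul (u v : R ⊗[k] H) (x : R) :
    toEnd ρ (leftMul ρ u v) x = toEnd ρ u (toEnd ρ v x) := by
  induction u with
  | zero => simp
  | add a b ha hb => simp [ha, hb]
  | tmul r h =>
    induction v with
    | zero => simp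
    | add a b ha hb => simp [ha, hb]
    | tmul s g =>
      rw [leftMul_tmul, Module.End.mul_apply, leftH_tmul ρ (ℛ k h), toEnd_tmul, toEnd_tmul,
        ρ.act_mul_repr (ℛ k h)]
      simp [leftR_tmul, toEnd_tmul, Finset.mul_sum, mul_assoc]

/-- The Auslander map `R # H → End_{R^H}(R)`, `r # h ↦ (x ↦ r (h ▷ x))`. Here `R` is regarded as a
right `R^H`-module, that is, as a module over the opposite ring of `R^H`. -/
noncomputable def auslanderMap : SmashProduct ρ →ₐ[k] Module.End ρ.invariants.op R :=
  AlgHom.ofLinearMap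
    { toFun := fun u =>
        { toFun := toEnd ρ u
          map_add' := map_add (toEnd ρ u)
          map_smul' := fun c x => toEnd_mul_invariant ρ u x c.2 }
      map_add' := fun u v => LinearMap.ext fun x => congr($(map_add (toEnd ρ) u v) x)
      map_smul' := fun c u => LinearMap.ext fun x => congr($(map_smul (toEnd ρ) c u) x) }
    (LinearMap.ext fun x => by
      change 1 * ρ.act 1 x = x
      simp)
    (fun u v => LinearMap.ext fun x => toEnd_leftMul ρ u v x)

theorem auslanderMap_mk (r : R) (h : H) (x : R) :
    auslanderMap ρ (mk ρ r h) x = r * ρ.act h x := rfl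

end SmashProduct

/-- A ring `B` is prime if it is nonzero and `a B b = 0` implies `a = 0` or `b = 0`; equivalently,
the product of two nonzero two-sided ideals is nonzero. -/
def IsPrimeRing (B : Type*) [Ring B] : Prop :=
  Nontrivial B ∧ ∀ a b : B, (∀ x : B, a * x * b = 0) → a = 0 ∨ b = 0

/-! Both properties follow from one statement: an element x of the smash product vanishes if φ(x)
kills s · w' for all s in R and all translates (for kG) or homogeneous components (for the dual) w'
of a fixed w ≠ 0. Taking w = 1 gives injectivity of φ. If x(R # H)y = 0 and y ≠ 0, taking w =
φ(y)(r) ≠ 0 gives x = 0.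

For kG the statement is proved only for x supported on the subgroup N of elements acting on R by
conjugation with units of the division ring D of fractions. This suffices, because a nonzero
two-sided ideal contains a nonzero element supported on N: one of minimal support
(`exists_ne_zero_support_subset_innerSubgroup`). The group N is abelian: units implementing elements
of G form a central-by-finite group, so by Schur their commutators have finite order, hence are
scalars, and scalars do not affect conjugation (`innerSubgroup_mul_comm`). So R is a sum of
eigenspaces for N. The characters that occur form a monoid, since R is a domain, and they separate
N, since the action is faithful. Testing x on products of eigenvectors and applying Dedekind's
independence of characters kills all coefficients.

For the dual, the action is a G-grading. The degrees that occur form a submonoid of a finite group,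
hence a subgroup, and inner faithfulness makes it all of G (`exists_homogeneous`). Thus s · w' can
be given any degree, and each coefficient of x is tested separately. -/

open scoped TensorProduct nonZeroDivisors commutatorElement

/-! ### The division ring of fractions of a noetherian domain -/

section Ore

variable {R : Type*} [Ring R] [IsDomain R] [IsNoetherianRing R]

/-- Two nonzero principal left ideals of a left noetherian domain intersect nontrivially. -/
theorem exists_ne_zero_mul_eq_mul_of_isNoetherianRing (r : R) {s : R} (hs : s ≠ 0) :
    ∃ d n : R, d ≠ 0 ∧ d * r = n * s := by
  by_contra! h
  -- Without such a relation, (x, y) ↦ x s + y r would embed R × R into the noetherian module R,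
  -- forcing R = 0.
  let f : R × R →ₗ[R] R :=
    (LinearMap.toSpanSingleton R R s).coprod (LinearMap.toSpanSingleton R R r)
  have hf : Function.Injective f := by
    rw [injective_iff_map_eq_zero]
    rintro ⟨x, y⟩ hxy
    have hxy' : x * s + y * r = 0 := hxy
    have hy : y = 0 := by
      by_contra hy
      exact h y (-x) hy (by rw [neg_mul]; exact eq_neg_of_add_eq_zero_right hxy')
    subst hy
    simpa [hs] using hxy'
  have := (IsNoetherian.equivPUnitOfProdInjective f hf).toEquiv.subsingleton
  exact zero_ne_one (Subsingleton.elim (0 : R) 1)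

/-- The nonzero elements of a left noetherian domain form a left Ore set. -/
@[reducible]
noncomputable def oreSetOfIsNoetherianRing : OreLocalization.OreSet R⁰ :=
  have h (r : R) (s : R⁰) : ∃ p : R × R⁰, p.2 * r = p.1 * s := by
    obtain ⟨d, n, hd, hdn⟩ :=
      exists_ne_zero_mul_eq_mul_of_isNoetherianRing r (nonZeroDivisors.ne_zero s.2)
    exact ⟨(n, ⟨d, mem_nonZeroDivisors_of_ne_zero hd⟩), hdn⟩
  OreLocalization.oreSetOfNoZeroDivisors (fun r s => (h r s).choose.1)
    (fun r s => (h r s).choose.2) (fun r s => (h r s).choose_spec)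

end Ore

/-- A left noetherian domain embeds into a division algebra, such that whatever centralizes its
image is central. -/
theorem exists_divisionRing_embedding.{u, v} (k : Type u) (R : Type v) [Field k] [Ring R] [Algebra k R] [IsDomain R]
    [IsNoetherianRing R] :
    ∃ (D : Type v) (_ : DivisionRing D) (_ : Algebra k D) (ι : R →ₐ[k] D),
      Function.Injective ι ∧ ∀ d : D, (∀ r, Commute d (ι r)) → ∀ d', Commute d d' := by
  let _ : OreLocalization.OreSet R⁰ := oreSetOfIsNoetherianRing
  refine ⟨OreLocalization R⁰ R, inferInstance, inferInstance,
    { OreLocalization.numeratorRingHom with commutes' := fun _ => rfl }, ?_, ?_⟩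
  · exact OreLocalization.numeratorHom_inj fun _ hx => hx.1
  · intro d hd d'
    induction d' using OreLocalization.ind with
    | _ r s =>
      -- Every element of D is a left fraction s⁻¹ r, and the centralizer of d is closed under
      -- inverses and products.
      have e : (r /ₒ s : OreLocalization R⁰ R) =
          (OreLocalization.numeratorHom (s : R))⁻¹ * OreLocalization.numeratorHom r := by
        rw [eq_inv_mul_iff_mul_eq₀ (OreLocalization.numerator_isUnit s).ne_zero]
        exact OreLocalization.mul_cancel
      rw [e]
      exact (hd s).inv_right₀.mul_right (hd r)

/-! ### Inner automorphisms -/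

section Inner

variable {k G R D : Type*} [Field k] [Group G] [Ring R] [Algebra k R]
  [DivisionRing D] [Algebra k D]

/-- The units of `D` which implement on `R` the action of some element of `G`. -/
def implementingUnits (σ : G →* (R →ₐ[k] R)) (ι : R →ₐ[k] D) : Subgroup Dˣ where
  carrier := {u | ∃ g, ∀ r, u * ι r = ι (σ g r) * u}
  mul_mem' := by
    rintro u v ⟨g, hg⟩ ⟨h, hh⟩
    refine ⟨g * h, fun r => ?_⟩
    rw [Units.val_mul, mul_assoc, hh, ← mul_assoc, hg, map_mul, mul_assoc]
    rfl
  one_mem' := ⟨1, by simp⟩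
  inv_mem' := by
    rintro u ⟨g, hg⟩
    refine ⟨g⁻¹, fun r => ?_⟩
    rw [Units.inv_mul_eq_iff_eq_mul, ← mul_assoc, hg, Units.mul_inv_cancel_right,
      ← AlgHom.mul_apply, ← map_mul, mul_inv_cancel, map_one, AlgHom.one_apply]

/-- The elements of `G` which act on `R` by conjugation with a unit of `D`. -/
def innerSubgroup (σ : G →* (R →ₐ[k] R)) (ι : R →ₐ[k] D) : Subgroup G where
  carrier := {g | ∃ u : Dˣ, ∀ r, u * ι r = ι (σ g r) * u}
  mul_mem' := by
    rintro g h ⟨u, hg⟩ ⟨v, hh⟩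
    refine ⟨u * v, fun r => ?_⟩
    rw [Units.val_mul, mul_assoc, hh, ← mul_assoc, hg, map_mul, mul_assoc]
    rfl
  one_mem' := ⟨1, by simp⟩
  inv_mem' := by
    rintro g ⟨u, hg⟩
    refine ⟨u⁻¹, fun r => ?_⟩
    rw [Units.inv_mul_eq_iff_eq_mul, ← mul_assoc, hg, Units.mul_inv_cancel_right,
      ← AlgHom.mul_apply, ← map_mul, mul_inv_cancel, map_one, AlgHom.one_apply]

/-- An element of finite multiplicative order of a division algebra over an algebraically closed
field is a scalar. -/
theorem exists_algebraMap_eq_of_pow_eq_one [IsAlgClosed k] (d : D) {n : ℕ} (hn : n ≠ 0)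
    (hd : d ^ n = 1) : ∃ c : k, algebraMap k D c = d := by
  -- Since D has no zero divisors, the minimal polynomial of d is irreducible, hence linear over k.
  have : IsIntegral k d := ⟨Polynomial.X ^ n - 1, Polynomial.monic_X_pow_sub_C 1 hn, by simp [hd]⟩
  exact minpoly.mem_range_of_degree_eq_one k d
    (IsAlgClosed.degree_eq_one_of_irreducible k (minpoly.irreducible this))

theorem commutatorElement_mul_central {Γ : Type*} [Group Γ] (u v : Γ) {z w : Γ}
    (hz : ∀ x, z * x = x * z) (hw : ∀ x, w * x = x * w) : ⁅u * z, v * w⁆ = ⁅u, v⁆ := by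
  rw [commutatorElement_def, ← div_eq_mul_inv, ← div_eq_mul_inv, div_eq_iff_eq_mul,
    div_eq_iff_eq_mul, commutatorElement_def]
  calc u * z * (v * w) = u * (z * v) * w := by group
    _ = u * v * (z * w) := by rw [hz]; group
    _ = u * v * u⁻¹ * (u * w) * z := by rw [hz]; group
    _ = _ := by rw [← hw]; group

/-- Two units implementing the same element of G differ by a factor that commutes with the image of
R, hence is central. A commutator therefore depends only on the two implemented elements of G. -/
theorem finite_commutatorSet_implementingUnits [Finite G] (σ : G →* (R →ₐ[k] R)) (ι : R →ₐ[k] D)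
    (hD : ∀ d : D, (∀ r, Commute d (ι r)) → ∀ d', Commute d d') :
    Finite (commutatorSet (implementingUnits σ ι)) := by
  choose f hf using fun u : implementingUnits σ ι => u.2
  have key (u v : implementingUnits σ ι) (h : f u = f v) :
      ∃ z : implementingUnits σ ι, u = v * z ∧ ∀ w, z * w = w * z := by
    refine ⟨v⁻¹ * u, by simp, fun w => ?_⟩
    apply Subtype.ext
    apply Units.ext
    refine hD _ (fun r => ?_) _
    have h1 := hf u r
    rw [h] at h1
    change ((v : Dˣ)⁻¹ * (u : Dˣ) : Dˣ).1 * ι r = ι r * ((v : Dˣ)⁻¹ * (u : Dˣ) : Dˣ).1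
    rw [Units.val_mul, mul_assoc, h1, Units.inv_mul_eq_iff_eq_mul, ← mul_assoc, ← mul_assoc, hf v,
      Units.mul_inv_cancel_right]
  refine (Set.Finite.subset (Set.toFinite (Set.range fun p : Set.range f × Set.range f =>
    ⁅p.1.2.choose, p.2.2.choose⁆)) ?_).to_subtype
  rintro _ ⟨u, v, rfl⟩
  refine ⟨(⟨f u, u, rfl⟩, ⟨f v, v, rfl⟩), ?_⟩
  have hu := (⟨f u, u, rfl⟩ : Set.range f).2.choose_spec
  have hv := (⟨f v, v, rfl⟩ : Set.range f).2.choose_spec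
  obtain ⟨z, hz, hzc⟩ := key _ _ hu
  obtain ⟨w, hw, hwc⟩ := key _ _ hv
  dsimp only at hz hw ⊢
  rw [hz, hw]
  exact commutatorElement_mul_central u v hzc hwc

/-- For a faithful action on `R`, the group of inner elements of `G` is commutative: the group of
implementing units is central-by-finite, hence has a finite commutator subgroup by Schur's
theorem, and so its commutators are scalars. -/
theorem innerSubgroup_mul_comm [IsAlgClosed k] [Finite G] (σ : G →* (R →ₐ[k] R)) (ι : R →ₐ[k] D)
    (hσ : ∀ g, (∀ r, σ g r = r) → g = 1) (hι : Function.Injective ι)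
    (hD : ∀ d : D, (∀ r, Commute d (ι r)) → ∀ d', Commute d d') {g h : G}
    (hg : g ∈ innerSubgroup σ ι) (hh : h ∈ innerSubgroup σ ι) : g * h = h * g := by
  have := finite_commutatorSet_implementingUnits σ ι hD
  obtain ⟨u, hu⟩ := hg
  obtain ⟨v, hv⟩ := hh
  let u' : implementingUnits σ ι := ⟨u, g, hu⟩
  let v' : implementingUnits σ ι := ⟨v, h, hv⟩
  have hc : ⁅u', v'⁆ ∈ commutator (implementingUnits σ ι) :=
    Subgroup.commutator_mem_commutator trivial trivial
  -- Schur's theorem enters as an instance: finitely many commutators generate a finite commutator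
  -- subgroup.
  obtain ⟨n, hn, hpow⟩ :=
    isOfFinOrder_iff_pow_eq_one.1 (isOfFinOrder_of_finite (⟨_, hc⟩ : commutator _))
  have hpow' : ((u * v * u⁻¹ * v⁻¹ : Dˣ) : D) ^ n = 1 := by
    have := congrArg (fun x => (((x : commutator (implementingUnits σ ι)) :
      implementingUnits σ ι) : Dˣ).1) hpow
    simpa [commutatorElement_def, u', v'] using this
  obtain ⟨c, hc⟩ := exists_algebraMap_eq_of_pow_eq_one (k := k) _ hn.ne' hpow'
  have huv : (u * v : D) = algebraMap k D c * (v * u) := by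
    rw [hc]
    simp [mul_assoc]
  -- The products u v and v u differ by the scalar c, so they induce the same conjugation.
  have hgh (r : R) : σ (g * h) r = σ (h * g) r := by
    apply hι
    have h1 : (u * v : D) * ι r = ι (σ (g * h) r) * (u * v) := by
      rw [mul_assoc, hv, ← mul_assoc, hu, map_mul, mul_assoc]; rfl
    have h2 : (v * u : D) * ι r = ι (σ (h * g) r) * (v * u) := by
      rw [mul_assoc, hu, ← mul_assoc, hv, map_mul, mul_assoc]; rfl
    have hne : (u * v : D) ≠ 0 := (u * v).ne_zero
    apply mul_right_cancel₀ hne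
    rw [← h1, huv, mul_assoc, h2, ← mul_assoc, ← mul_assoc, Algebra.commutes, mul_assoc, mul_assoc]
  have := hσ ((h * g)⁻¹ * (g * h)) fun r => by
    rw [map_mul, AlgHom.mul_apply, hgh, ← AlgHom.mul_apply, ← map_mul, inv_mul_cancel, map_one,
      AlgHom.one_apply]
  exact (inv_mul_eq_one.1 this).symm

/-- Let `I` be a nonzero set of elements `∑ g, a g # g` of the skew group ring of `G` which is
closed under subtraction, under multiplication with elements of `R` from both sides and under
multiplication with elements of `G` from the right. Then `I` has a nonzero element supported on
the inner elements of `G`. -/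
theorem exists_ne_zero_support_subset_innerSubgroup [Finite G] [IsDomain R]
    (σ : G →* (R →ₐ[k] R)) (ι : R →ₐ[k] D) (hι : Function.Injective ι) (I : Set (G → R))
    (hsub : ∀ a ∈ I, ∀ b ∈ I, a - b ∈ I) (hleft : ∀ a ∈ I, ∀ r, (fun g => r * a g) ∈ I)
    (hright : ∀ a ∈ I, ∀ r, (fun g => a g * σ g r) ∈ I)
    (htrans : ∀ a ∈ I, ∀ h, (fun g => a (g * h)) ∈ I) (hI : ∃ a ∈ I, a ≠ 0) :
    ∃ a ∈ I, a ≠ 0 ∧ ∀ g, a g ≠ 0 → g ∈ innerSubgroup σ ι := by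
  classical
  let P : Set ℕ := {n | ∃ a ∈ I, a ≠ 0 ∧ (Function.support a).ncard = n}
  have hP : P.Nonempty := let ⟨a, ha, ha0⟩ := hI; ⟨_, a, ha, ha0, rfl⟩
  obtain ⟨a, ha, ha0, han⟩ := WellFounded.min_mem wellFounded_lt P hP
  have hmin (b : G → R) (hb : b ∈ I) (hlt : (Function.support b).ncard <
      (Function.support a).ncard) : b = 0 := by
    by_contra hb0
    exact WellFounded.not_lt_min wellFounded_lt P (show _ ∈ P from ⟨b, hb, hb0, rfl⟩) (han ▸ hlt)
  obtain ⟨h, hh⟩ := Function.ne_iff.1 ha0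
  -- Translating moves 1 into the support and keeps its size.
  let b : G → R := fun g => a (g * h)
  have hb1 : b 1 ≠ 0 := by simpa [b] using hh
  have hbcard : (Function.support b).ncard = (Function.support a).ncard := by
    have : Function.support b = (fun g => g * h) ⁻¹' Function.support a := rfl
    rw [this]
    exact Set.ncard_preimage_of_injective_subset_range (mul_left_injective h)
      (fun g _ => ⟨g * h⁻¹, by simp⟩)
  have hb : b ∈ I := htrans a ha h
  refine ⟨b, hb, fun h0 => hb1 (by rw [h0]; rfl), fun g hg => ?_⟩
  -- The difference of the two sides, as a function of g, lies in I, is supported in the support of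
  -- b and vanishes at 1. By minimality it is zero.
  have hrel (r : R) : b 1 * r * b g = b g * σ g (r * b 1) := by
    have hc := hmin _ (hsub _ (hleft b hb (b 1 * r)) _ (hright b hb (r * b 1))) (by
      rw [← hbcard]
      refine Set.ncard_lt_ncard ⟨fun g hg hg0 => hg ?_, fun hle => hle (a := 1) hb1 ?_⟩
        (Set.toFinite _)
      · simp [hg0]
      · simp [mul_assoc])
    exact sub_eq_zero.1 (congrFun hc g)
  have hA : ι (b 1) ≠ 0 := by simpa [map_eq_zero_iff _ hι] using hb1
  have hB : ι (b g) ≠ 0 := by simpa [map_eq_zero_iff _ hι] using hg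
  -- The relation at r = 1 expresses σ g (b 1) through b 1 and b g. Substituting this in the general
  -- relation shows that (b g)⁻¹ b 1 implements g.
  refine ⟨(Units.mk0 _ hB)⁻¹ * Units.mk0 _ hA, fun r => ?_⟩
  have h1 : ι (b 1) * ι (b g) = ι (b g) * ι (σ g (b 1)) := by
    rw [← map_mul, ← map_mul]
    simpa using congrArg ι (hrel 1)
  have h2 : ι (b 1) * ι r * ι (b g) = ι (b g) * ι (σ g r) * ι (σ g (b 1)) := by
    simpa [mul_assoc] using congrArg ι (hrel r)
  have h3 : ι (σ g (b 1)) = (ι (b g))⁻¹ * (ι (b 1) * ι (b g)) := by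
    rw [h1, inv_mul_cancel_left₀ hB]
  rw [h3, ← mul_assoc, ← mul_assoc, mul_left_inj' hB] at h2
  rw [Units.val_mul, Units.val_inv_eq_inv_val, Units.val_mk0, Units.val_mk0, mul_assoc, h2,
    mul_assoc, mul_assoc, inv_mul_cancel_left₀ hB]

end Inner

/-! ### Diagonal actions of finite abelian groups -/

section Diagonal

variable {k N R : Type*} [Field k] [CommGroup N] [Fintype N] [Ring R] [Algebra k R]

/-- The projection, up to a scalar, to the eigenspace of the character `χ`. -/
noncomputable def eigenProj (σ : N →* (R →ₐ[k] R)) (χ : N →* kˣ) (r : R) : R :=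
  ∑ n, (χ n⁻¹ : k) • σ n r

theorem apply_eigenProj (σ : N →* (R →ₐ[k] R)) (χ : N →* kˣ) (r : R) (m : N) :
    σ m (eigenProj σ χ r) = (χ m : k) • eigenProj σ χ r := by
  simp only [eigenProj, map_sum, map_smul, Finset.smul_sum, ← AlgHom.mul_apply, ← map_mul]
  refine Fintype.sum_equiv (Equiv.mulLeft m) _ _ fun n => ?_
  simp only [Equiv.coe_mulLeft, mul_inv_rev, map_mul, Units.val_mul, smul_smul]
  rw [mul_comm (χ n⁻¹ : k), ← mul_assoc, map_inv χ m, Units.mul_inv, one_mul]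

theorem sum_characters_eq_zero [IsAlgClosed k] [CharZero k] [Fintype (N →* kˣ)] {n : N}
    (hn : n ≠ 1) : ∑ χ : N →* kˣ, (χ n : k) = 0 := by
  obtain ⟨φ, hφ⟩ := CommGroup.exists_apply_ne_one_of_hasEnoughRootsOfUnity N k hn
  -- Multiplication by φ permutes the characters, while φ n ≠ 1.
  have h : (φ n : k) * ∑ χ : N →* kˣ, (χ n : k) = ∑ χ : N →* kˣ, (χ n : k) := by
    rw [Finset.mul_sum]
    exact Fintype.sum_equiv (Equiv.mulLeft φ) _ _ fun χ => by simp
  have : ((φ n : k) - 1) * ∑ χ : N →* kˣ, (χ n : k) = 0 := by rw [sub_mul, h]; simp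
  refine (mul_eq_zero.1 this).resolve_left fun h0 => hφ (Units.ext (sub_eq_zero.1 h0))

theorem sum_eigenProj [IsAlgClosed k] [CharZero k] [Fintype (N →* kˣ)] (σ : N →* (R →ₐ[k] R))
    (r : R) : ∑ χ, eigenProj σ χ r = (Fintype.card (N →* kˣ) : k) • r := by
  simp only [eigenProj]
  rw [Finset.sum_comm]
  simp_rw [← Finset.sum_smul]
  rw [Finset.sum_eq_single 1]
  · simp
  · intro n _ hn
    rw [sum_characters_eq_zero (inv_ne_one.2 hn), zero_smul]
  · simp

theorem exists_eigenProj_ne_zero [IsAlgClosed k] [CharZero k] (σ : N →* (R →ₐ[k] R)) {r : R}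
    (hr : r ≠ 0) : ∃ χ, eigenProj σ χ r ≠ 0 := by
  have := Fintype.ofFinite (N →* kˣ)
  by_contra! h
  have := sum_eigenProj σ r
  simp only [h, Finset.sum_const_zero] at this
  exact (smul_ne_zero (Nat.cast_ne_zero.2 Fintype.card_ne_zero) hr) this.symm

variable [IsDomain R]

/-- The characters which occur in `R`. -/
def eigenCharacters (σ : N →* (R →ₐ[k] R)) : Submonoid (N →* kˣ) where
  carrier := {χ | ∃ x ≠ 0, ∀ n, σ n x = (χ n : k) • x}
  mul_mem' := by
    rintro χ ψ ⟨x, hx, hχ⟩ ⟨y, hy, hψ⟩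
    exact ⟨x * y, mul_ne_zero hx hy, fun n => by simp [hχ, hψ, smul_smul, mul_comm]⟩
  one_mem' := ⟨1, one_ne_zero, by simp⟩

/-- Up to a nonzero scalar, every r is the sum of its eigencomponents. Each of them is fixed by n,
so n acts trivially. -/
theorem eq_one_of_forall_eigenCharacters [IsAlgClosed k] [CharZero k] (σ : N →* (R →ₐ[k] R))
    (hσ : ∀ g, (∀ r, σ g r = r) → g = 1) {n : N} (hn : ∀ χ ∈ eigenCharacters σ, χ n = 1) :
    n = 1 := by
  have := Fintype.ofFinite (N →* kˣ)
  refine hσ n fun r => ?_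
  have h (χ : N →* kˣ) : σ n (eigenProj σ χ r) = eigenProj σ χ r := by
    by_cases h0 : eigenProj σ χ r = 0
    · simp [h0]
    · rw [apply_eigenProj, hn χ ⟨_, h0, apply_eigenProj σ χ r⟩, Units.val_one, one_smul]
  have h' := congrArg (σ n) (sum_eigenProj σ r)
  rw [map_sum, map_smul] at h'
  simp only [h, sum_eigenProj] at h'
  exact (smul_right_injective R (Nat.cast_ne_zero.2 Fintype.card_ne_zero) h').symm

/-- By Dedekind's independence of characters, the elements of `N` are linearly independent as
functions on the characters which occur in `R`. -/
theorem eq_zero_of_forall_eigenCharacters [IsAlgClosed k] [CharZero k] (σ : N →* (R →ₐ[k] R))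
    (hσ : ∀ g, (∀ r, σ g r = r) → g = 1) (a : N → R)
    (ha : ∀ χ ∈ eigenCharacters σ, ∑ n, (χ n : k) • a n = 0) : a = 0 := by
  -- Duality: n becomes a character of the monoid of occurring characters. These evaluations are
  -- distinct because that monoid separates N.
  let ev (n : N) : eigenCharacters σ →* k :=
    { toFun := fun χ => (χ.1 n : k), map_one' := by simp, map_mul' := by simp }
  have hev : Function.Injective ev := fun m n hmn => by
    rw [← inv_mul_eq_one]
    refine eq_one_of_forall_eigenCharacters σ hσ fun χ hχ => ?_
    rw [map_mul, map_inv, inv_mul_eq_one]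
    exact Units.ext (DFunLike.congr_fun hmn ⟨χ, hχ⟩)
  have hli := (linearIndependent_monoidHom (eigenCharacters σ) k).comp ev hev
  funext n
  -- Linear functionals on R reduce the coefficients in R to scalars.
  refine (Module.forall_dual_apply_eq_zero_iff k (a n)).1 fun f => ?_
  refine Fintype.linearIndependent_iff.1 hli (fun n => f (a n)) (funext fun χ => ?_) n
  have := congrArg f (ha χ.1 χ.2)
  simpa [ev, mul_comm] using this

/-- Combining the translates of w replaces it by a nonzero eigencomponent, of character χ. For s an
eigenvector of character ψ, the nonzero factor s · w cancels and leaves ∑ ψ(n) χ(n) a n = 0, to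
which Dedekind's theorem applies. -/
theorem eq_zero_of_forall_sum_mul_eq_zero [IsAlgClosed k] [CharZero k] (σ : N →* (R →ₐ[k] R))
    (hσ : ∀ g, (∀ r, σ g r = r) → g = 1) (a : N → R) {w : R} (hw : w ≠ 0)
    (h : ∀ (s : R) (m : N), ∑ n, a n * σ n (s * σ m w) = 0) : a = 0 := by
  obtain ⟨χ, hχ⟩ := exists_eigenProj_ne_zero σ hw
  have h' (s : R) : ∑ n, a n * σ n (s * eigenProj σ χ w) = 0 := by
    simp only [eigenProj, Finset.mul_sum, map_sum, mul_smul_comm, map_smul]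
    rw [Finset.sum_comm]
    simp only [← Finset.smul_sum, h, smul_zero, Finset.sum_const_zero]
  have hz := eq_zero_of_forall_eigenCharacters σ hσ (fun n => (χ n : k) • a n) (by
    rintro ψ ⟨x, hx, hψ⟩
    have := h' x
    simp only [map_mul, apply_eigenProj, hψ, mul_smul_comm, smul_mul_assoc] at this
    simp only [← mul_assoc, ← smul_mul_assoc, ← Finset.sum_mul] at this
    simpa [hx, hχ, smul_smul, mul_comm] using this)
  funext n
  simpa using congrFun hz n

end Diagonal

/-! ### Kernels of Hopf algebra maps -/

/-- The kernel of a surjective map of Hopf algebras is a Hopf ideal. -/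
theorem isHopfIdeal_ker {k H H' : Type*} [Field k] [Ring H] [HopfAlgebra k H] [Ring H']
    [HopfAlgebra k H'] (f : H →ₐ[k] H') (hf : Function.Surjective f)
    (hcounit : ∀ x, Coalgebra.counit (R := k) (f x) = Coalgebra.counit (R := k) x)
    (hcomul : ∀ x, Coalgebra.comul (R := k) (f x) =
      TensorProduct.map f.toLinearMap f.toLinearMap (Coalgebra.comul x))
    (hantipode : ∀ x, HopfAlgebra.antipode k (f x) = f (HopfAlgebra.antipode k x)) :
    (RingHom.ker f).IsHopfIdeal k := by
  refine @Ideal.IsHopfIdeal.mk _ _ _ _ _ _ ⟨fun x hx => ?_, fun x hx => ?_⟩ fun x hx => ?_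
  · have hx : f x = 0 := hx
    rw [← hcounit, hx, map_zero]
  · have hx : f x = 0 := hx
    -- With a linear section of f, the quotient map by the kernel factors through f. Its tensor
    -- square therefore sends Δ(x) to an image of Δ(f x) = 0.
    obtain ⟨s, hs⟩ := f.toLinearMap.exists_rightInverse_of_surjective
      (LinearMap.range_eq_top.2 hf)
    have hj : ((RingHom.ker f).restrictScalars k).mkQ =
        (((RingHom.ker f).restrictScalars k).mkQ ∘ₗ s) ∘ₗ f.toLinearMap := by
      ext y
      refine (Submodule.Quotient.eq _).2 ?_
      have := LinearMap.congr_fun hs (f y)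
      simpa [RingHom.mem_ker, sub_eq_zero] using this.symm
    rw [hj, TensorProduct.map_comp, LinearMap.comp_apply, ← hcomul, hx, map_zero, map_zero]
  · have hx : f x = 0 := hx
    rw [RingHom.mem_ker, ← hantipode, hx, map_zero]

/-! ### Elements of smash products in terms of a basis -/

namespace SmashProduct

variable {k H R : Type*} [Field k] [Ring H] [HopfAlgebra k H] [Ring R] [Algebra k R]
variable (ρ : HopfAction k H R)

theorem mk_add_left (r s : R) (h : H) : mk ρ (r + s) h = mk ρ r h + mk ρ s h :=
  TensorProduct.add_tmul r s h

theorem mk_sub_left (r s : R) (h : H) : mk ρ (r - s) h = mk ρ r h - mk ρ s h :=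
  TensorProduct.sub_tmul r s h

theorem mk_zero_left (h : H) : mk ρ 0 h = 0 := TensorProduct.zero_tmul R h

variable {ι : Type*} [Fintype ι]

/-- The element `∑ i, a i # b i`. -/
noncomputable def ofCoeffs (b : ι → H) (a : ι → R) : SmashProduct ρ := ∑ i, mk ρ (a i) (b i)

theorem ofCoeffs_zero (b : ι → H) : ofCoeffs ρ b 0 = 0 :=
  Finset.sum_eq_zero fun _ _ => mk_zero_left ρ _

theorem ofCoeffs_add (b : ι → H) (a a' : ι → R) :
    ofCoeffs ρ b (a + a') = ofCoeffs ρ b a + ofCoeffs ρ b a' := by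
  simp [ofCoeffs, mk_add_left, Finset.sum_add_distrib]

theorem ofCoeffs_sub (b : ι → H) (a a' : ι → R) :
    ofCoeffs ρ b (a - a') = ofCoeffs ρ b a - ofCoeffs ρ b a' := by
  simp [ofCoeffs, mk_sub_left, Finset.sum_sub_distrib]

/-- Spanning is enough: elements are shown to vanish by finding zero coefficients, so uniqueness of
coefficients plays no role. -/
theorem exists_ofCoeffs_eq {b : ι → H} (hb : ⊤ ≤ Submodule.span k (Set.range b))
    (x : SmashProduct ρ) : ∃ a, ofCoeffs ρ b a = x := by
  classical
  induction x using TensorProduct.induction_on with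
  | zero => exact ⟨0, ofCoeffs_zero ρ b⟩
  | add x y hx hy =>
    obtain ⟨a, rfl⟩ := hx
    obtain ⟨a', rfl⟩ := hy
    exact ⟨a + a', ofCoeffs_add ρ b a a'⟩
  | tmul r h =>
    obtain ⟨c, rfl⟩ :=
      (Submodule.mem_span_range_iff_exists_fun k).1 (hb (Submodule.mem_top (x := h)))
    refine ⟨fun i => c i • r, ?_⟩
    change _ = r ⊗ₜ[k] _
    rw [TensorProduct.tmul_sum]
    exact Finset.sum_congr rfl fun i _ => TensorProduct.smul_tmul _ _ _

theorem auslanderMap_ofCoeffs (b : ι → H) (a : ι → R) (x : R) :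
    auslanderMap ρ (ofCoeffs ρ b a) x = ∑ i, a i * ρ.act (b i) x := by
  rw [ofCoeffs, map_sum, LinearMap.sum_apply]
  rfl

theorem nontrivial_of_nontrivial [Nontrivial R] : Nontrivial (SmashProduct ρ) := by
  refine ⟨0, 1, fun h => zero_ne_one (α := R) ?_⟩
  have := congrArg (fun x => auslanderMap ρ x 1) h
  simp at this

end SmashProduct

/-! ### Actions of group algebras -/

namespace HopfAction

section GroupAlgebra

variable {k G R : Type*} [Field k] [Group G] [Ring R] [Algebra k R]

/-- The action of the group elements by automorphisms. -/
noncomputable def groupAction (ρ : HopfAction k (MonoidAlgebra k G) R) : G →* (R →ₐ[k] R) where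
  toFun g := AlgHom.ofLinearMap (ρ.act (MonoidAlgebra.single g 1))
    (by simp [ρ.act_one]) (fun a b => by simp [ρ.act_mul, TensorProduct.map_tmul])
  map_one' := by
    ext r
    change ρ.act (1 : MonoidAlgebra k G) r = r
    simp
  map_mul' g h := by
    ext r
    change ρ.act (MonoidAlgebra.single (g * h) 1) r =
      ρ.act (MonoidAlgebra.single g 1) (ρ.act (MonoidAlgebra.single h 1) r)
    rw [← Module.End.mul_apply, ← map_mul]
    simp

theorem groupAction_apply (ρ : HopfAction k (MonoidAlgebra k G) R) (g : G) (r : R) :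
    ρ.groupAction g r = ρ.act (MonoidAlgebra.single g 1) r := rfl

/-- If the kernel K of the action on R were nontrivial, the kernel of kG → k[G/K] would be a Hopf
ideal containing g - 1 ≠ 0 and annihilating R. -/
theorem groupAction_faithful (ρ : HopfAction k (MonoidAlgebra k G) R) (hρ : ρ.InnerFaithful)
    (g : G) (hg : ∀ r, ρ.groupAction g r = r) : g = 1 := by
  by_contra hg1
  let K := ρ.groupAction.ker
  have hgK : g ∈ K := AlgHom.ext hg
  let f := MonoidAlgebra.mapDomainBialgHom k (QuotientGroup.mk' K)
  let f' : MonoidAlgebra k G →ₐ[k] MonoidAlgebra k (G ⧸ K) := f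
  have hf (m : G) (c : k) : f' (MonoidAlgebra.single m c) = MonoidAlgebra.single (m : G ⧸ K) c :=
    MonoidAlgebra.mapDomainBialgHom_single _ _ _
  have hsurj : Function.Surjective f' := fun y => by
    induction y using MonoidAlgebra.induction_on with
    | of m =>
      obtain ⟨m, rfl⟩ := QuotientGroup.mk_surjective m
      exact ⟨_, hf m 1⟩
    | add x y hx hy =>
      obtain ⟨x, rfl⟩ := hx
      obtain ⟨y, rfl⟩ := hy
      exact ⟨x + y, map_add _ _ _⟩
    | smul c x hx =>
      obtain ⟨x, rfl⟩ := hx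
      exact ⟨c • x, map_smul _ _ _⟩
  have hanti : HopfAlgebra.antipode k ∘ₗ f'.toLinearMap =
      f'.toLinearMap ∘ₗ HopfAlgebra.antipode k := by
    ext m
    simp [hf]
  have hHopf := isHopfIdeal_ker f' hsurj (fun x => CoalgHomClass.counit_comp_apply f x)
    (fun x => (CoalgHomClass.map_comp_comul_apply f x).symm)
    (fun x => LinearMap.congr_fun hanti x)
  have hne : RingHom.ker f' ≠ ⊥ := by
    intro h
    have hmem : MonoidAlgebra.single g (1 : k) - 1 ∈ RingHom.ker f' := by
      rw [RingHom.mem_ker, map_sub, map_one, hf, (QuotientGroup.eq_one_iff g).2 hgK]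
      simp [MonoidAlgebra.one_def]
    rw [h, Ideal.mem_bot, sub_eq_zero, MonoidAlgebra.one_def] at hmem
    exact hg1 (MonoidAlgebra.of_injective (R := k) hmem)
  obtain ⟨x, hx, r, hxr⟩ := hρ _ inferInstance hHopf hne
  -- the action factors through the group algebra of `G ⧸ K`
  let σ' : (G ⧸ K) →* Module.End k R := QuotientGroup.lift K
    { toFun := fun g => ρ.act (MonoidAlgebra.single g 1)
      map_one' := by rw [← MonoidAlgebra.one_def, map_one]
      map_mul' := fun g h => by rw [← map_mul]; simp }
    (fun m hm => LinearMap.ext fun r => AlgHom.congr_fun hm r)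
  have hfac : (MonoidAlgebra.lift k _ _ σ').comp f' = ρ.act := by
    ext m r
    simp [hf, σ']
    rfl
  apply hxr
  rw [← hfac, AlgHom.comp_apply, RingHom.mem_ker.1 hx, map_zero]
  rfl

end GroupAlgebra

end HopfAction

/-! ### Skew group rings: injectivity and primeness -/

namespace SmashProduct

section GroupAlgebra

variable {k G R : Type*} [Field k] [Group G] [Ring R] [Algebra k R]
variable (ρ : HopfAction k (MonoidAlgebra k G) R)

theorem mk_single_mul_mk_single (r s : R) (g h : G) :
    mk ρ r (MonoidAlgebra.single g 1) * mk ρ s (MonoidAlgebra.single h 1) =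
      mk ρ (r * ρ.groupAction g s) (MonoidAlgebra.single (g * h) 1) := by
  let A : Coalgebra.Repr k (MonoidAlgebra.single g (1 : k)) Unit :=
    { index := Finset.univ
      left := fun _ => MonoidAlgebra.single g 1
      right := fun _ => MonoidAlgebra.single g 1
      eq := by simp }
  rw [mk_mul_mk ρ r s _ _ A]
  simp [A, ρ.groupAction_apply]

variable [Fintype G]

/-- The element `∑ g, a g # g`. -/
noncomputable def ofGroup (a : G → R) : SmashProduct ρ :=
  ofCoeffs ρ (fun g => MonoidAlgebra.single g 1) a

theorem exists_ofGroup_eq (x : SmashProduct ρ) : ∃ a, ofGroup ρ a = x := by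
  refine exists_ofCoeffs_eq ρ ?_ x
  rintro y -
  induction y using MonoidAlgebra.induction_on with
  | of m => exact Submodule.subset_span ⟨m, rfl⟩
  | add x y hx hy => exact add_mem hx hy
  | smul c x hx => exact Submodule.smul_mem _ _ hx

theorem auslanderMap_ofGroup (a : G → R) (x : R) :
    auslanderMap ρ (ofGroup ρ a) x = ∑ g, a g * ρ.groupAction g x :=
  auslanderMap_ofCoeffs ρ _ a x

theorem mk_one_mul_ofGroup (r : R) (a : G → R) :
    mk ρ r (MonoidAlgebra.single 1 1) * ofGroup ρ a = ofGroup ρ fun g => r * a g := by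
  simp only [ofGroup, ofCoeffs, Finset.mul_sum, mk_single_mul_mk_single]
  simp

theorem ofGroup_mul_mk_one (r : R) (a : G → R) :
    ofGroup ρ a * mk ρ r (MonoidAlgebra.single 1 1) =
      ofGroup ρ fun g => a g * ρ.groupAction g r := by
  simp only [ofGroup, ofCoeffs, Finset.sum_mul, mk_single_mul_mk_single]
  simp

theorem ofGroup_mul_one_mk (h : G) (a : G → R) :
    ofGroup ρ a * mk ρ 1 (MonoidAlgebra.single h⁻¹ 1) = ofGroup ρ fun g => a (g * h) := by
  simp only [ofGroup, ofCoeffs, Finset.sum_mul, mk_single_mul_mk_single]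
  exact Fintype.sum_equiv (Equiv.mulRight h⁻¹) _ _ fun g => by simp

variable [IsDomain R]

variable {D : Type*} [DivisionRing D] [Algebra k D] (ι : R →ₐ[k] D)

/-- If an additive subgroup of the skew group ring, closed under right multiplication and under
left multiplication with elements of `R`, has a nonzero element, then it has a nonzero element
supported on the inner elements of `G`. -/
theorem exists_ofGroup_support_subset_innerSubgroup (hι : Function.Injective ι)
    (p : SmashProduct ρ → Prop) (hsub : ∀ x y, p x → p y → p (x - y))
    (hleft : ∀ x y, p y → p (x * y)) (hright : ∀ x y, p x → p (x * y)) {x : SmashProduct ρ}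
    (hx : x ≠ 0) (hpx : p x) :
    ∃ a : G → R, p (ofGroup ρ a) ∧ a ≠ 0 ∧ ∀ g, a g ≠ 0 → g ∈ innerSubgroup ρ.groupAction ι := by
  obtain ⟨a, rfl⟩ := exists_ofGroup_eq ρ x
  refine exists_ne_zero_support_subset_innerSubgroup ρ.groupAction ι hι {a | p (ofGroup ρ a)}
    ?_ ?_ ?_ ?_ ⟨a, hpx, ?_⟩
  · intro a ha b hb
    have := hsub _ _ ha hb
    rwa [ofGroup, ofGroup, ← ofCoeffs_sub] at this
  · intro a ha r
    have := hleft (mk ρ r (MonoidAlgebra.single 1 1)) _ ha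
    rwa [mk_one_mul_ofGroup] at this
  · intro a ha r
    have := hright _ (mk ρ r (MonoidAlgebra.single 1 1)) ha
    rwa [ofGroup_mul_mk_one] at this
  · intro a ha h
    have := hright _ (mk ρ 1 (MonoidAlgebra.single h⁻¹ 1)) ha
    rwa [ofGroup_mul_one_mk] at this
  · rintro rfl
    exact hx (ofCoeffs_zero ρ _)

/-- The inner elements form an abelian group acting faithfully, so the diagonal case applies to the
restriction of a. -/
theorem eq_zero_of_support_subset_innerSubgroup [IsAlgClosed k] [CharZero k]
    (hρ : ρ.InnerFaithful) (hι : Function.Injective ι)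
    (hD : ∀ d : D, (∀ r, Commute d (ι r)) → ∀ d', Commute d d') {a : G → R}
    (ha : ∀ g, a g ≠ 0 → g ∈ innerSubgroup ρ.groupAction ι) {w : R} (hw : w ≠ 0)
    (h : ∀ (s : R) (m : G), auslanderMap ρ (ofGroup ρ a) (s * ρ.groupAction m w) = 0) : a = 0 := by
  classical
  let N := innerSubgroup ρ.groupAction ι
  have hfaith := ρ.groupAction_faithful hρ
  let _ : CommGroup N :=
    { mul_comm := fun x y => Subtype.ext (innerSubgroup_mul_comm _ ι hfaith hι hD x.2 y.2) }
  let _ : Fintype N := Fintype.ofFinite N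
  have hN : (fun n : N => a n) = 0 := by
    refine eq_zero_of_forall_sum_mul_eq_zero (ρ.groupAction.comp N.subtype)
      (fun g hg => Subtype.ext (hfaith g hg)) _ hw fun s m => ?_
    rw [← h s m, auslanderMap_ofGroup]
    refine Finset.sum_of_injOn Subtype.val Subtype.val_injective.injOn (by simp) ?_ (by simp)
    intro g _ hg
    have : a g = 0 := by
      by_contra h0
      exact hg ⟨⟨g, ha g h0⟩, by simp⟩
    rw [this, zero_mul]
  funext g
  by_contra h0
  exact h0 (congrFun hN ⟨g, ha g h0⟩)

variable [IsNoetherianRing R] [IsAlgClosed k] [CharZero k]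

theorem auslanderMap_injective_of_groupAlgebra (hρ : ρ.InnerFaithful) :
    Function.Injective (auslanderMap ρ) := by
  obtain ⟨D, _, _, ι, hι, hD⟩ := exists_divisionRing_embedding k R
  rw [injective_iff_map_eq_zero]
  intro x hx
  by_contra hx0
  -- The two-sided ideal here is the kernel of the Auslander map.
  obtain ⟨a, ha, ha0, hsupp⟩ := exists_ofGroup_support_subset_innerSubgroup ρ ι hι
    (fun x => auslanderMap ρ x = 0) (fun x y hx hy => by rw [map_sub, hx, hy, sub_zero])
    (fun x y hy => by rw [map_mul, hy, mul_zero]) (fun x y hx => by rw [map_mul, hx, zero_mul])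
    hx0 hx
  exact ha0 (eq_zero_of_support_subset_innerSubgroup ρ ι hρ hι hD hsupp one_ne_zero
    fun s m => by rw [ha]; rfl)

theorem isPrimeRing_of_groupAlgebra (hρ : ρ.InnerFaithful) : IsPrimeRing (SmashProduct ρ) := by
  obtain ⟨D, _, _, ι, hι, hD⟩ := exists_divisionRing_embedding k R
  refine ⟨nontrivial_of_nontrivial ρ, fun x y hxy => ?_⟩
  by_contra! hne
  -- The condition x B y = 0, with B the smash product, defines a two-sided ideal in x for fixed y,
  -- and then in y for fixed x. Hence both factors can be replaced by elements supported on inner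
  -- elements.
  obtain ⟨a, ha, ha0, hasupp⟩ := exists_ofGroup_support_subset_innerSubgroup ρ ι hι
    (fun x => ∀ z, x * z * y = 0)
    (fun u v hu hv z => by rw [sub_mul, sub_mul, hu, hv, sub_zero])
    (fun u v hv z => by rw [mul_assoc u, mul_assoc u, hv, mul_zero])
    (fun u v hu z => by rw [mul_assoc u, hu]) hne.1 hxy
  obtain ⟨b, hb, hb0, hbsupp⟩ := exists_ofGroup_support_subset_innerSubgroup ρ ι hι
    (fun y => ∀ z, ofGroup ρ a * z * y = 0)
    (fun u v hu hv z => by rw [mul_sub, hu, hv, sub_zero])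
    (fun u v hv z => by rw [← mul_assoc, mul_assoc _ z, hv])
    (fun u v hu z => by rw [← mul_assoc, hu, zero_mul]) hne.2 ha
  have hw : ∃ r, auslanderMap ρ (ofGroup ρ b) r ≠ 0 := by
    by_contra! h
    exact hb0 (eq_zero_of_support_subset_innerSubgroup ρ ι hρ hι hD hbsupp one_ne_zero
      fun s m => h _)
  obtain ⟨r, hr⟩ := hw
  -- With w = φ(b)(r), the value φ(a)(s · σ_m(w)) is φ(a (s # m) b)(r) = 0.
  refine ha0 (eq_zero_of_support_subset_innerSubgroup ρ ι hρ hι hD hasupp hr fun s m => ?_)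
  have := congrArg (fun x => auslanderMap ρ x r) (hb (mk ρ s (MonoidAlgebra.single m 1)))
  simpa [Module.End.mul_apply, auslanderMap_mk, ← ρ.groupAction_apply] using this

end GroupAlgebra

end SmashProduct

/-! ### The dual of a group algebra -/

namespace HopfDual

section GroupAlgebra

variable {k G : Type*} [Field k] [Group G]

theorem ext_single {f g : HopfDual k (MonoidAlgebra k G)}
    (h : ∀ m, f (MonoidAlgebra.single m 1) = g (MonoidAlgebra.single m 1)) : f = g := by
  apply (equivDual k (MonoidAlgebra k G)).injective
  ext m
  exact h m

/-- Group elements are grouplike, so convolution is pointwise on G. -/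
theorem mul_apply_single (f g : HopfDual k (MonoidAlgebra k G)) (m : G) :
    (f * g) (MonoidAlgebra.single m 1) =
      f (MonoidAlgebra.single m 1) * g (MonoidAlgebra.single m 1) := by
  let A : Coalgebra.Repr k (MonoidAlgebra.single m (1 : k)) Unit :=
    { index := Finset.univ
      left := fun _ => MonoidAlgebra.single m 1
      right := fun _ => MonoidAlgebra.single m 1
      eq := by simp }
  simp [mul_apply f g A, A]

/-- The functional which reads off the coefficient of `g`. -/
noncomputable def coord (k : Type*) {G : Type*} [Field k] [Group G] (g : G) :
    HopfDual k (MonoidAlgebra k G) :=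
  (equivDual k (MonoidAlgebra k G)).symm
    (Finsupp.lapply g ∘ₗ (MonoidAlgebra.coeffLinearEquiv k).toLinearMap)

/-- Restriction of functionals to the group algebra of a subgroup. -/
noncomputable def restrict (S : Subgroup G) :
    HopfDual k (MonoidAlgebra k G) →ₐ[k] HopfDual k (MonoidAlgebra k S) :=
  AlgHom.ofLinearMap ((equivDual k _).symm.toLinearMap ∘ₗ
    (MonoidAlgebra.mapDomainBialgHom k S.subtype : MonoidAlgebra k S →ₗ[k] _).dualMap ∘ₗ
      (equivDual k _).toLinearMap)
    (ext_single fun m => by simp)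
    (fun f g => ext_single fun m => by
      rw [mul_apply_single]
      simp [mul_apply_single])

theorem restrict_apply_single (S : Subgroup G) (f : HopfDual k (MonoidAlgebra k G)) (m : S) :
    restrict S f (MonoidAlgebra.single m 1) = f (MonoidAlgebra.single (m : G) 1) := by
  simp [restrict]

variable [DecidableEq G]

theorem coord_apply_single (g m : G) :
    coord k g (MonoidAlgebra.single m 1) = if m = g then 1 else 0 := by
  simp [coord, Finsupp.single_apply]

theorem mul_coord (f : HopfDual k (MonoidAlgebra k G)) (g : G) :
    f * coord k g = f (MonoidAlgebra.single g 1) • coord k g := by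
  refine ext_single fun m => ?_
  rw [mul_apply_single, smul_apply, coord_apply_single]
  split_ifs with h
  · rw [h]
  · simp

variable [Fintype G]

theorem sum_coord : ∑ g, coord k g = (1 : HopfDual k (MonoidAlgebra k G)) := by
  refine ext_single fun m => ?_
  rw [← equivDual_apply, map_sum, LinearMap.sum_apply]
  simp [coord_apply_single]

theorem eq_sum_smul_coord (f : HopfDual k (MonoidAlgebra k G)) :
    f = ∑ g, f (MonoidAlgebra.single g 1) • coord k g := by
  conv_lhs => rw [← mul_one f, ← sum_coord, Finset.mul_sum]
  simp only [mul_coord]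

/-- Transposing the multiplication of kG: the product m n equals g exactly when n = m⁻¹ g. -/
theorem comul_coord (g : G) :
    Coalgebra.comul (R := k) (coord k g) = ∑ h, coord k h ⊗ₜ[k] coord k (h⁻¹ * g) := by
  apply (pairing k (MonoidAlgebra k G)).injective
  ext m n
  have h : pairing k (MonoidAlgebra k G) (Coalgebra.comul (coord k g))
      (MonoidAlgebra.single m 1 ⊗ₜ MonoidAlgebra.single n 1) =
      pairing k (MonoidAlgebra k G) (∑ h, coord k h ⊗ₜ[k] coord k (h⁻¹ * g))
      (MonoidAlgebra.single m 1 ⊗ₜ MonoidAlgebra.single n 1) := by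
    rw [pairing_comul, map_sum, LinearMap.sum_apply]
    simp only [pairing_tmul, coord_apply_single, MonoidAlgebra.single_mul_single, mul_one,
      eq_inv_mul_iff_mul_eq]
    rw [Finset.sum_eq_single m (fun d _ hd => by simp [Ne.symm hd]) (by simp)]
    simp
  simpa using h

theorem restrict_surjective (S : Subgroup G) :
    Function.Surjective (restrict (k := k) S) := by
  classical
  intro f
  have := Fintype.ofFinite S
  -- Extension by zero outside S.
  refine ⟨∑ m : S, f (MonoidAlgebra.single m 1) • coord k (m : G), ext_single fun n => ?_⟩
  rw [restrict_apply_single, ← equivDual_apply, map_sum, LinearMap.sum_apply]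
  simp [coord_apply_single]

omit [DecidableEq G] in
theorem pairing_map_restrict (S : Subgroup G)
    (t : HopfDual k (MonoidAlgebra k G) ⊗[k] HopfDual k (MonoidAlgebra k G)) (m n : S) :
    pairing k (MonoidAlgebra k S)
        (TensorProduct.map (restrict S).toLinearMap (restrict S).toLinearMap t)
        (MonoidAlgebra.single m 1 ⊗ₜ MonoidAlgebra.single n 1) =
      pairing k (MonoidAlgebra k G) t
        (MonoidAlgebra.single (m : G) 1 ⊗ₜ MonoidAlgebra.single (n : G) 1) := by
  induction t with
  | zero => simp
  | tmul f g => simp [restrict_apply_single]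
  | add x y hx hy => simp only [map_add, LinearMap.add_apply, hx, hy]

theorem isHopfIdeal_ker_restrict (S : Subgroup G) :
    (RingHom.ker (restrict (k := k) S)).IsHopfIdeal k := by
  refine isHopfIdeal_ker _ (restrict_surjective S) (fun f => ?_) (fun f => ?_) fun f => ?_
  · rw [counit_apply, counit_apply, MonoidAlgebra.one_def, MonoidAlgebra.one_def,
      restrict_apply_single]
    rfl
  · apply (pairing k (MonoidAlgebra k S)).injective
    ext m n
    have h := pairing_map_restrict S (Coalgebra.comul f) m n
    rw [pairing_comul, MonoidAlgebra.single_mul_single, mul_one] at h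
    have h' : pairing k (MonoidAlgebra k S) (Coalgebra.comul (restrict S f))
        (MonoidAlgebra.single m 1 ⊗ₜ MonoidAlgebra.single n 1) = _ := pairing_comul _ _ _
    rw [MonoidAlgebra.single_mul_single, mul_one, restrict_apply_single, Subgroup.coe_mul,
      ← h] at h'
    simpa using h'
  · refine ext_single fun m => ?_
    rw [antipode_apply, restrict_apply_single, antipode_apply]
    simp [restrict_apply_single]

end GroupAlgebra

end HopfDual

/-! ### Actions of the dual of a group algebra -/

namespace HopfAction

section GroupAlgebraDual

open HopfDual

variable {k G R : Type*} [Field k] [Group G] [Fintype G] [DecidableEq G] [Ring R] [Algebra k R]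
variable (ρ : HopfAction k (HopfDual k (MonoidAlgebra k G)) R)

/-- The projection of `R` to its homogeneous component of degree `g`. -/
noncomputable def homogProj (g : G) : Module.End k R := ρ.act (coord k g)

theorem sum_homogProj (r : R) : ∑ g, ρ.homogProj g r = r := by
  simp only [homogProj]
  rw [← LinearMap.sum_apply, ← map_sum, sum_coord, map_one, Module.End.one_apply]

theorem homogProj_homogProj (g h : G) (r : R) :
    ρ.homogProj g (ρ.homogProj h r) = if g = h then ρ.homogProj h r else 0 := by
  rw [homogProj, homogProj, ← Module.End.mul_apply, ← map_mul, mul_coord, coord_apply_single,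
    map_smul]
  simp only [eq_comm (a := h)]
  split_ifs <;> simp

theorem exists_homogProj_ne_zero {r : R} (hr : r ≠ 0) : ∃ g, ρ.homogProj g r ≠ 0 := by
  by_contra! h
  exact hr (by rw [← ρ.sum_homogProj r]; exact Finset.sum_eq_zero fun g _ => h g)

theorem homogProj_mul (g : G) (a b : R) :
    ρ.homogProj g (a * b) = ∑ h, ρ.homogProj h a * ρ.homogProj (h⁻¹ * g) b := by
  simp [homogProj, ρ.act_mul, comul_coord]

theorem homogProj_mul_of_homogeneous {g h : G} {a b : R} (ha : ρ.homogProj g a = a)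
    (hb : ρ.homogProj h b = b) : ρ.homogProj (g * h) (a * b) = a * b := by
  rw [homogProj_mul, Finset.sum_eq_single g]
  · rw [inv_mul_cancel_left, ha, hb]
  · intro m _ hm
    rw [← ha, homogProj_homogProj, if_neg hm, zero_mul]
  · simp

theorem homogProj_one : ρ.homogProj 1 1 = 1 := by
  rw [homogProj, ρ.act_one, counit_apply, MonoidAlgebra.one_def, coord_apply_single]
  simp

variable [IsDomain R]

/-- The degrees which occur in `R`. -/
def degreeSubmonoid : Submonoid G where
  carrier := {g | ∃ x ≠ 0, ρ.homogProj g x = x}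
  mul_mem' := by
    rintro g h ⟨x, hx, hgx⟩ ⟨y, hy, hhy⟩
    exact ⟨x * y, mul_ne_zero hx hy, ρ.homogProj_mul_of_homogeneous hgx hhy⟩
  one_mem' := ⟨1, one_ne_zero, ρ.homogProj_one⟩

/-- The degrees which occur in `R`, as a subgroup. -/
def degreeSubgroup : Subgroup G where
  __ := ρ.degreeSubmonoid
  inv_mem' {g} hg := by
    -- In a finite group inverses are powers, so a submonoid is a subgroup.
    have h : g⁻¹ = g ^ (orderOf g - 1) := by
      rw [inv_eq_iff_mul_eq_one, ← pow_succ', Nat.sub_add_cancel (orderOf_pos g), pow_orderOf_eq_one]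
    rw [h]
    exact ρ.degreeSubmonoid.pow_mem hg _

/-- If the action is inner faithful, then every degree occurs. -/
theorem exists_homogeneous (hρ : ρ.InnerFaithful) (g : G) : ∃ x ≠ 0, ρ.homogProj g x = x := by
  by_contra hg
  let S := ρ.degreeSubgroup
  have hgS : g ∉ S := hg
  -- A missing degree g gives the nonzero functional `coord k g`, which vanishes on S.
  have hne : RingHom.ker (restrict (k := k) S) ≠ ⊥ := by
    intro h
    have hmem : coord k g ∈ RingHom.ker (restrict (k := k) S) := by
      refine ext_single fun m => ?_
      rw [restrict_apply_single, coord_apply_single, if_neg]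
      · rfl
      · rintro rfl
        exact hgS m.2
    rw [h, Ideal.mem_bot] at hmem
    have := congrArg (fun f => f (MonoidAlgebra.single g 1)) hmem
    simp [coord_apply_single] at this
  obtain ⟨f, hf, r, hr⟩ := hρ _ inferInstance (isHopfIdeal_ker_restrict S) hne
  apply hr
  -- The kernel annihilates R: f vanishes on the degrees in S, and R has no components in the
  -- others.
  rw [eq_sum_smul_coord f, map_sum, LinearMap.sum_apply]
  refine Finset.sum_eq_zero fun m _ => ?_
  rw [map_smul, LinearMap.smul_apply]
  change _ • ρ.homogProj m r = 0
  by_cases h0 : ρ.homogProj m r = 0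
  · rw [h0, smul_zero]
  · have hm : m ∈ S := ⟨_, h0, by rw [homogProj_homogProj, if_pos rfl]⟩
    have := restrict_apply_single S f ⟨m, hm⟩
    rw [RingHom.mem_ker.1 hf] at this
    rw [← this, HopfDual.zero_apply, zero_smul]

end GroupAlgebraDual

end HopfAction

/-! ### Smash products with the dual of a group algebra: injectivity and primeness -/

namespace SmashProduct

section GroupAlgebraDual

open HopfDual

variable {k G R : Type*} [Field k] [Group G] [Fintype G] [DecidableEq G] [Ring R] [Algebra k R]
variable (ρ : HopfAction k (HopfDual k (MonoidAlgebra k G)) R)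

theorem exists_ofCoeffs_coord_eq (x : SmashProduct ρ) : ∃ a, ofCoeffs ρ (coord k) a = x := by
  refine exists_ofCoeffs_eq ρ ?_ x
  rintro f -
  rw [eq_sum_smul_coord f]
  exact sum_mem fun g _ => Submodule.smul_mem _ _ (Submodule.subset_span ⟨g, rfl⟩)

theorem auslanderMap_ofCoeffs_of_homogeneous (a : G → R) {g : G} {x : R}
    (hx : ρ.homogProj g x = x) : auslanderMap ρ (ofCoeffs ρ (coord k) a) x = a g * x := by
  rw [auslanderMap_ofCoeffs]
  change ∑ h, a h * ρ.homogProj h x = _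
  rw [← hx]
  simp [ρ.homogProj_homogProj]

variable [IsDomain R]

/-- An element of the smash product vanishes if it annihilates the left ideal generated by the
homogeneous components of some nonzero element of `R`. -/
theorem eq_zero_of_forall_mul_homogProj (hρ : ρ.InnerFaithful) {x : SmashProduct ρ} {w : R}
    (hw : w ≠ 0) (h : ∀ s g, auslanderMap ρ x (s * ρ.homogProj g w) = 0) : x = 0 := by
  obtain ⟨a, rfl⟩ := exists_ofCoeffs_coord_eq ρ x
  obtain ⟨m, hm⟩ := ρ.exists_homogProj_ne_zero hw
  have ha : a = 0 := by
    funext g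
    -- This degree puts the product of s with the m-component of w in degree g, where the element
    -- acts as multiplication by a g.
    obtain ⟨s, hs, hs'⟩ := ρ.exists_homogeneous hρ (g * m⁻¹)
    have hprod := ρ.homogProj_mul_of_homogeneous hs'
      (show ρ.homogProj m (ρ.homogProj m w) = _ by rw [ρ.homogProj_homogProj, if_pos rfl])
    rw [inv_mul_cancel_right] at hprod
    have := h s m
    rw [auslanderMap_ofCoeffs_of_homogeneous ρ a hprod] at this
    exact (mul_eq_zero.1 this).resolve_right (mul_ne_zero hs hm)
  rw [ha, ofCoeffs_zero]

theorem auslanderMap_injective_of_groupAlgebraDual (hρ : ρ.InnerFaithful) :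
    Function.Injective (auslanderMap ρ) := by
  rw [injective_iff_map_eq_zero]
  intro x hx
  exact eq_zero_of_forall_mul_homogProj ρ hρ one_ne_zero fun s g => by rw [hx]; rfl

theorem isPrimeRing_of_groupAlgebraDual (hρ : ρ.InnerFaithful) :
    IsPrimeRing (SmashProduct ρ) := by
  refine ⟨nontrivial_of_nontrivial ρ, fun x y hxy => or_iff_not_imp_right.2 fun hy => ?_⟩
  obtain ⟨r, hr⟩ : ∃ r, auslanderMap ρ y r ≠ 0 := by
    by_contra! h
    exact hy (auslanderMap_injective_of_groupAlgebraDual ρ hρ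
      (by rw [map_zero]; exact LinearMap.ext h))
  -- With w = φ(y)(r), the value to be killed is φ(x (s # p_g) y)(r), where p_g is `coord k g`.
  refine eq_zero_of_forall_mul_homogProj ρ hρ hr fun s g => ?_
  have := congrArg (fun z => auslanderMap ρ z r) (hxy (mk ρ s (coord k g)))
  simpa [Module.End.mul_apply, auslanderMap_mk, HopfAction.homogProj] using this

end GroupAlgebraDual

end SmashProduct

theorem proposition1p14 (k G R : Type*) [Field k] [IsAlgClosed k] [CharZero k]
    [Group G] [Finite G] [Ring R] [Algebra k R] [IsDomain R]
    [IsNoetherianRing R] [IsNoetherianRing Rᵐᵒᵖ] :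
    (∀ ρ : HopfAction k (MonoidAlgebra k G) R, ρ.InnerFaithful →
      Function.Injective (SmashProduct.auslanderMap ρ) ∧ IsPrimeRing (SmashProduct ρ)) ∧
    (∀ ρ : HopfAction k (HopfDual k (MonoidAlgebra k G)) R, ρ.InnerFaithful →
      Function.Injective (SmashProduct.auslanderMap ρ) ∧ IsPrimeRing (SmashProduct ρ)) := by
  classical
  have := Fintype.ofFinite G
  exact ⟨fun ρ hρ => ⟨SmashProduct.auslanderMap_injective_of_groupAlgebra ρ hρ,
      SmashProduct.isPrimeRing_of_groupAlgebra ρ hρ⟩,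
    fun ρ hρ => ⟨SmashProduct.auslanderMap_injective_of_groupAlgebraDual ρ hρ,
      SmashProduct.isPrimeRing_of_groupAlgebraDual ρ hρ⟩⟩
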